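/- Let $(X_j)_{j\ge 1}$ be discrete real random variables on a probability space (each $X_j$ takes values almost surely in a countable set). For a possible value $x$ of $X_j$ (that is, $\mathbb P(X_j=x)>0$) put $F_j(x)=\mathbb P(X_j\le x)$, $F_j^-(x)=\mathbb P(X_j<x)$. Define the mean-value-$\chi^2$ and the median-value-$\chi^2$ statistics $$\ddot Z_j=\frac{1}{F_j(X_j)-F_j^-(X_j)}\int_{F_j^-(X_j)}^{F_j(X_j)}(-2\log u)\,du,\qquad \tilde Z_j=-2\log\frac{F_j(X_j)+F_j^-(X_j)}{2},$$ their moments $\nu_j=\mathrm{Var}(\ddot Z_j)$, $m_j=\mathbb E(\tilde Z_j)$, $v_j=\mathrm{Var}(\tilde Z_j)$, the averages $\bar\nu=\frac1n\sum_{j=1}^n\nu_j$, $\bar m=\frac1n\sum_{j=1}^n m_j$, $\bar v=\frac1n\sum_{j=1}^n v_j$, and the sums $S_n=\sum_{j=1}^n\ddot Z_j$, $\tilde S_n=\sum_{j=1}^n\tilde Z_j$. Let $G(\cdot;\alpha,\beta)$ be the distribution function of the gamma distribution with shape $\alpha>0$ and scale $\beta>0$, and $q_{p;\alpha,\beta}=\inf\{x: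 G(x;\alpha,\beta)\ge p\}$ its $p$-quantile. Suppose that the random variables $(\ddot Z_j)_{j\ge1}$ are independent, that the random variables $(\tilde Z_j)_{j\ge1}$ are independent, that $\nu_j>0$ for at least one $j$ and $v_j>0$ for at least one $j$, and that the Lyapunov conditions hold: for some $\delta,\tilde\delta>0$, $$\lim_{n\to\infty}\frac{\sum_{j=1}^n\mathbb E\big(|\ddot Z_j-2|^{2+\delta}\big)}{\big(\sum_{j=1}^n\nu_j\big)^{1+\delta/2}}=0\quad\text{and}\quad \lim_{n\to\infty}\frac{\sum_{j=1}^n\mathbb E\big(|\tilde Z_j-m_j|^{2+\tilde\delta}\big)}{\big(\sum_{j=1}^n v_j\big)^{1+\tilde\delta/2}}=0 .$$ Then, for every $p\in(0,1)$, $$\lim_{n\to\infty}\mathbb P\big(S_n<q_{p;\,4n/\bar\nu,\;\bar\nu/2}\big)=p\quad\text{and}\quad \lim_{n\to\infty}\mathbb P\big(\tilde S_n<q_{p;\,n\bar m^2/\bar v,\;\bar v/\bar m}\big)=p .$$ -/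

import Mathlib

open MeasureTheory ProbabilityTheory Filter Topology

noncomputable section

/-- The mean-value-`χ²` score of the outcome `x` of a discrete statistic with law `ρ`: with
`F₋ = P(X < x)` and `F = P(X ≤ x)`, the average of `-2 log p` over the interval `[F₋, F]`. -/
def meanValueChiSq (ρ : Measure ℝ) (x : ℝ) : ℝ :=
  (∫ p in (ρ.real (Set.Iio x))..(ρ.real (Set.Iic x)), -2 * Real.log p) /
    (ρ.real (Set.Iic x) - ρ.real (Set.Iio x))

/-- The median-value-`χ²` score of the outcome `x` of a discrete statistic with law `ρ`:
`-2 log` of the mid-p-value `(P(X ≤ x) + P(X < x)) / 2`. -/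
def medianValueChiSq (ρ : Measure ℝ) (x : ℝ) : ℝ :=
  -2 * Real.log ((ρ.real (Set.Iic x) + ρ.real (Set.Iio x)) / 2)

/-- The mean-value-`χ²` statistic of the random variable `X`. -/
def meanStat {Ω : Type*} [MeasurableSpace Ω] (μ : Measure Ω) (X : Ω → ℝ) : Ω → ℝ :=
  fun ω => meanValueChiSq (μ.map X) (X ω)

/-- The median-value-`χ²` statistic of the random variable `X`. -/
def medianStat {Ω : Type*} [MeasurableSpace Ω] (μ : Measure Ω) (X : Ω → ℝ) : Ω → ℝ :=
  fun ω => medianValueChiSq (μ.map X) (X ω)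

/-- The average of the first `n` terms of a real sequence. -/
def avg (a : ℕ → ℝ) (n : ℕ) : ℝ := (∑ j ∈ Finset.range n, a j) / n

/-- The `p`-quantile `inf {x : G(x; α, β) ≥ p}` of the gamma distribution with shape `α` and
*scale* `β`, that is, with rate `β⁻¹`. -/
def gammaQuantile (p α β : ℝ) : ℝ := sInf {x : ℝ | p ≤ cdf (gammaMeasure α β⁻¹) x}

end

/-! Let `M n` and `V n` be the mean and variance of the sum of the first n scores. The gamma law in
the statement has the same mean and variance, and after standardisation both it and the sum converge
to the standard normal law. The normal distribution function is continuous and strictly increasing,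
so the gamma p-quantile, in standardised units, tends to the normal one, and the probability tends
to p (`tendsto_measureReal_lt_sInf`).

For the sum this is Lyapunov's theorem (`tendsto_charFun_sum_of_lyapunov`). For the gamma law it
needs the shape `M n ^ 2 / V n` to tend to infinity (`tendsto_charFun_gammaMeasure`), which follows
once the scores have means at least 1 and uniformly bounded variances.

These bounds hold for every discrete law because the intervals from F₋(x) to F(x) over the atoms
tile the unit interval (`lintegral_eq_of_mul_singleton_eq`). Tiling gives mean exactly 2 for the
mean-value score, and mean 1/2 for the mid-p-value y, whence -2 log y ≥ 2(1 - y) has mean at least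
1. Both scores are at most 2 - 2 log F(X), and the mean of F(X)^(-1/2) is at most the integral of
u^(-1/2), which is 2; this bounds an exponential moment and hence the variances. -/

/-! ### Lyapunov's theorem via characteristic functions -/

theorem norm_exp_mul_I_sub_taylor_le (x : ℝ) {ε δ : ℝ} (hε : 0 < ε) (hδ : 0 < δ) :
    ‖Complex.exp (x * Complex.I) - (1 + x * Complex.I - x ^ 2 / 2)‖ ≤
      4 * (ε * x ^ 2 + ε ^ (-δ) * |x| ^ (2 + δ)) := by
  -- The cubic bound serves for |x| ≤ ε; the quadratic one serves beyond, where x² ≤ ε^(-δ)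
  -- |x|^(2+δ).
  have hsq : ‖Complex.exp (x * Complex.I) - (1 + x * Complex.I - x ^ 2 / 2)‖ ≤ 4 * x ^ 2 ∧
      ‖Complex.exp (x * Complex.I) - (1 + x * Complex.I - x ^ 2 / 2)‖ ≤ 4 * (|x| * x ^ 2) := by
    have hx2 : x ^ 2 = |x| ^ 2 := (sq_abs x).symm
    rcases le_total |x| 1 with h | h
    · have hb := Complex.exp_bound (x := x * Complex.I) (by simpa using h) (n := 3) (by norm_num)
      have e : ∑ m ∈ Finset.range 3, ((x : ℂ) * Complex.I) ^ m / (m.factorial : ℂ) =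
          1 + x * Complex.I - x ^ 2 / 2 := by
        simp [Finset.sum_range_succ, mul_pow, Nat.factorial]
        ring
      rw [e] at hb
      have hb' : ‖Complex.exp (x * Complex.I) - (1 + x * Complex.I - x ^ 2 / 2)‖ ≤
          |x| * |x| ^ 2 := by
        refine hb.trans ?_
        have : 0 ≤ |x| ^ 3 := by positivity
        simp [Nat.factorial]
        nlinarith
      rw [hx2]
      have : 0 ≤ |x| ^ 2 := by positivity
      have : 0 ≤ |x| := abs_nonneg x
      constructor <;> nlinarith
    · have hb : ‖Complex.exp (x * Complex.I) - (1 + x * Complex.I - x ^ 2 / 2)‖ ≤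
          1 + (1 + |x| + |x| ^ 2 / 2) := by
        refine (norm_sub_le _ _).trans ?_
        rw [Complex.norm_exp_ofReal_mul_I]
        gcongr
        refine (norm_sub_le _ _).trans ?_
        have h1 : ‖(1 : ℂ) + x * Complex.I‖ ≤ 1 + |x| := by
          refine (norm_add_le _ _).trans ?_
          simp
        have h2 : ‖(x : ℂ) ^ 2 / 2‖ = |x| ^ 2 / 2 := by simp
        linarith
      rw [hx2]
      constructor <;> nlinarith
  have hp : 0 ≤ ε ^ (-δ) * |x| ^ (2 + δ) := by positivity
  rcases le_total |x| ε with h | h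
  · refine hsq.2.trans ?_
    have : |x| * x ^ 2 ≤ ε * x ^ 2 := by gcongr
    linarith
  · refine hsq.1.trans ?_
    have hxpos : 0 < |x| := hε.trans_le h
    have : x ^ 2 ≤ ε ^ (-δ) * |x| ^ (2 + δ) := by
      rw [Real.rpow_add hxpos, Real.rpow_neg hε.le, Real.rpow_two, sq_abs, mul_left_comm]
      refine le_mul_of_one_le_right (sq_nonneg x) ?_
      rw [inv_mul_eq_div, one_le_div (by positivity)]
      gcongr
    have : 0 ≤ ε * x ^ 2 := by positivity
    linarith

theorem norm_exp_neg_sub_one_add_le {a : ℝ} (ha : 0 ≤ a) : |Real.exp (-a) - (1 - a)| ≤ a ^ 2 := by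
  have h1 := Real.add_one_le_exp (-a)
  have h2 := Real.add_one_le_exp a
  have h3 : Real.exp (-a) ≤ 1 - a + a ^ 2 := by
    rw [Real.exp_neg]
    refine inv_le_of_inv_le₀ (by nlinarith) ?_
    refine le_trans ?_ h2
    rw [inv_le_iff_one_le_mul₀ (by nlinarith)]
    -- (1 + a)(1 - a + a²) = 1 + a³.
    nlinarith [pow_nonneg ha 3]
  rw [abs_le]
  constructor <;> nlinarith

/-- Exchange the factors one at a time; the factors left alone have norm at most 1. -/
theorem norm_prod_sub_prod_le {ι R : Type*} [NormedCommRing R] [NormOneClass R] (s : Finset ι)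
    (f g : ι → R) (hf : ∀ i ∈ s, ‖f i‖ ≤ 1) (hg : ∀ i ∈ s, ‖g i‖ ≤ 1) :
    ‖∏ i ∈ s, f i - ∏ i ∈ s, g i‖ ≤ ∑ i ∈ s, ‖f i - g i‖ := by
  classical
  induction s using Finset.induction_on with
  | empty => simp
  | insert a s ha ih =>
    rw [Finset.prod_insert ha, Finset.prod_insert ha, Finset.sum_insert ha]
    have hp : ‖∏ i ∈ s, g i‖ ≤ 1 :=
      (Finset.norm_prod_le _ _).trans
        (Finset.prod_le_one (fun _ _ => norm_nonneg _) fun i hi => hg i (by simp [hi]))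
    have ih' := ih (fun i hi => hf i (by simp [hi])) (fun i hi => hg i (by simp [hi]))
    calc ‖f a * ∏ i ∈ s, f i - g a * ∏ i ∈ s, g i‖
        = ‖(f a - g a) * ∏ i ∈ s, g i + f a * (∏ i ∈ s, f i - ∏ i ∈ s, g i)‖ := by ring_nf
      _ ≤ ‖f a - g a‖ * ‖∏ i ∈ s, g i‖ + ‖f a‖ * ‖∏ i ∈ s, f i - ∏ i ∈ s, g i‖ :=
          (norm_add_le _ _).trans (add_le_add (norm_mul_le _ _) (norm_mul_le _ _))
      _ ≤ ‖f a - g a‖ * 1 + 1 * ∑ i ∈ s, ‖f i - g i‖ := by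
          gcongr
          exact hf a (by simp)
      _ = _ := by ring

section Moments

variable {Ω : Type*} [MeasurableSpace Ω] {μ : Measure Ω} [IsProbabilityMeasure μ]
  {Y : Ω → ℝ} {δ ε : ℝ}

/-- Split at |Y| = ε. This will show that no single summand carries a fixed share of the total
variance. -/
theorem integral_sq_le_of_integrable_rpow (hY : Integrable (fun ω => Y ω ^ 2) μ)
    (hYδ : Integrable (fun ω => |Y ω| ^ (2 + δ)) μ) (hε : 0 < ε) (hδ : 0 < δ) :
    ∫ ω, Y ω ^ 2 ∂μ ≤ ε ^ 2 + ε ^ (-δ) * ∫ ω, |Y ω| ^ (2 + δ) ∂μ := by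
  have : ∫ ω, Y ω ^ 2 ∂μ ≤ ∫ ω, (ε ^ 2 + ε ^ (-δ) * |Y ω| ^ (2 + δ)) ∂μ := by
    refine integral_mono hY ((integrable_const _).add (hYδ.const_mul _)) fun ω => ?_
    simp only
    have hp : 0 ≤ ε ^ (-δ) * |Y ω| ^ (2 + δ) := by positivity
    rcases le_total |Y ω| ε with h | h
    · have : Y ω ^ 2 ≤ ε ^ 2 := by
        rw [← sq_abs]; gcongr
      linarith
    · have hxpos : 0 < |Y ω| := hε.trans_le h
      have : Y ω ^ 2 ≤ ε ^ (-δ) * |Y ω| ^ (2 + δ) := by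
        rw [Real.rpow_add hxpos, Real.rpow_neg hε.le, Real.rpow_two, sq_abs, mul_left_comm]
        refine le_mul_of_one_le_right (sq_nonneg _) ?_
        rw [inv_mul_eq_div, one_le_div (by positivity)]
        gcongr
      nlinarith [sq_nonneg ε]
  rwa [integral_add (integrable_const _) (hYδ.const_mul _), integral_const_mul, integral_const,
    probReal_univ, one_smul] at this

theorem norm_charFun_map_sub_le (hm : AEMeasurable Y μ) (hY : Integrable (fun ω => Y ω ^ 2) μ)
    (hYδ : Integrable (fun ω => |Y ω| ^ (2 + δ)) μ) (h0 : ∫ ω, Y ω ∂μ = 0)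
    (hε : 0 < ε) (hδ : 0 < δ) (t : ℝ) :
    ‖charFun (μ.map Y) t - ((1 - t ^ 2 * (∫ ω, Y ω ^ 2 ∂μ) / 2 : ℝ) : ℂ)‖ ≤
      4 * (ε * t ^ 2 * ∫ ω, Y ω ^ 2 ∂μ +
        ε ^ (-δ) * |t| ^ (2 + δ) * ∫ ω, |Y ω| ^ (2 + δ) ∂μ) := by
  have hY1 : Integrable Y μ :=
    ((memLp_two_iff_integrable_sq hm.aestronglyMeasurable).2 hY).integrable (by norm_num)
  have hexp : Integrable (fun ω => Complex.exp ((t * Y ω : ℝ) * Complex.I)) μ := by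
    refine Integrable.of_bound (C := 1) ?_ (ae_of_all _ fun ω => ?_)
    · exact (by fun_prop : AEMeasurable _ μ).aestronglyMeasurable
    · rw [Complex.norm_exp_ofReal_mul_I]
  have hlin : Integrable (fun ω => (1 + (t * Y ω : ℝ) * Complex.I : ℂ)) μ :=
    (integrable_const _).add (((hY1.const_mul t).ofReal).mul_const _)
  have hquad : Integrable (fun ω => ((t * Y ω : ℝ) : ℂ) ^ 2 / 2) μ := by
    have := ((hY.const_mul (t ^ 2 / 2)).ofReal (𝕜 := ℂ))
    refine this.congr (ae_of_all _ fun ω => ?_)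
    simp; ring
  have hpoly : ∫ ω, (1 + (t * Y ω : ℝ) * Complex.I - ((t * Y ω : ℝ) : ℂ) ^ 2 / 2 : ℂ) ∂μ =
      ((1 - t ^ 2 * (∫ ω, Y ω ^ 2 ∂μ) / 2 : ℝ) : ℂ) := by
    rw [integral_sub hlin hquad, integral_add (integrable_const _)
      (((hY1.const_mul t).ofReal).mul_const _)]
    have e1 : ∫ ω, ((t * Y ω : ℝ) : ℂ) * Complex.I ∂μ = 0 := by
      rw [integral_mul_const, integral_complex_ofReal, integral_const_mul, h0]; simp
    have e2 : ∫ ω, ((t * Y ω : ℝ) : ℂ) ^ 2 / 2 ∂μ = ((t ^ 2 * (∫ ω, Y ω ^ 2 ∂μ) / 2 : ℝ) : ℂ) := by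
      rw [← integral_const_mul, ← integral_div, ← integral_complex_ofReal]
      congr 1; ext ω; push_cast; ring
    rw [e1, e2]; simp
  have hchar : charFun (μ.map Y) t = ∫ ω, Complex.exp ((t * Y ω : ℝ) * Complex.I) ∂μ := by
    rw [charFun_apply_real, integral_map hm (by fun_prop)]
    simp
  have hpolyint : Integrable (fun ω =>
      (1 + (t * Y ω : ℝ) * Complex.I - ((t * Y ω : ℝ) : ℂ) ^ 2 / 2 : ℂ)) μ := hlin.sub hquad
  rw [hchar, ← hpoly, ← integral_sub hexp hpolyint]
  have hb1 : Integrable (fun ω => ε * t ^ 2 * Y ω ^ 2) μ := hY.const_mul _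
  have hb2 : Integrable (fun ω => ε ^ (-δ) * |t| ^ (2 + δ) * |Y ω| ^ (2 + δ)) μ := hYδ.const_mul _
  refine (norm_integral_le_of_norm_le ((hb1.add hb2).const_mul 4)
    (ae_of_all _ fun ω => ?_)).trans_eq ?_
  · refine (norm_exp_mul_I_sub_taylor_le (t * Y ω) hε hδ).trans_eq ?_
    rw [abs_mul, Real.mul_rpow (abs_nonneg _) (abs_nonneg _)]
    simp only [Pi.add_apply]
    ring
  · simp only [Pi.add_apply]
    rw [integral_const_mul, integral_add hb1 hb2, integral_const_mul, integral_const_mul]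

end Moments

/-- **Lyapunov's central limit theorem** for centered independent variables. -/
theorem tendsto_charFun_sum_of_lyapunov {Ω : Type*} [MeasurableSpace Ω] {μ : Measure Ω}
    [IsProbabilityMeasure μ] {Y : ℕ → Ω → ℝ} {δ : ℝ} (hδ : 0 < δ)
    (hm : ∀ j, AEMeasurable (Y j) μ) (hY : ∀ j, Integrable (fun ω => Y j ω ^ 2) μ)
    (hYδ : ∀ j, Integrable (fun ω => |Y j ω| ^ (2 + δ)) μ) (h0 : ∀ j, ∫ ω, Y j ω ∂μ = 0)
    (hind : iIndepFun Y μ) {v : ℕ → ℝ} (hv : ∀ j, v j = ∫ ω, Y j ω ^ 2 ∂μ)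
    (hvpos : ∃ j, 0 < v j)
    (hLyap : Tendsto (fun n : ℕ =>
      (∑ j ∈ Finset.range n, ∫ ω, |Y j ω| ^ (2 + δ) ∂μ) /
        (∑ j ∈ Finset.range n, v j) ^ (1 + δ / 2)) atTop (𝓝 0)) (t : ℝ) :
    Tendsto (fun n : ℕ => charFun (μ.map fun ω =>
      (√(∑ j ∈ Finset.range n, v j))⁻¹ * ∑ j ∈ Finset.range n, Y j ω) t) atTop
      (𝓝 (Complex.exp (-t ^ 2 / 2))) := by
  set V : ℕ → ℝ := fun n => ∑ j ∈ Finset.range n, v j with hV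
  set L : ℕ → ℝ := fun n => (∑ j ∈ Finset.range n, ∫ ω, |Y j ω| ^ (2 + δ) ∂μ) /
    V n ^ (1 + δ / 2) with hL
  have hv0 : ∀ j, 0 ≤ v j := fun j => by rw [hv]; positivity
  have hVpos : ∀ᶠ n in atTop, 0 < V n := by
    obtain ⟨j, hj⟩ := hvpos
    filter_upwards [eventually_gt_atTop j] with n hn
    exact hj.trans_le (Finset.single_le_sum (f := v) (fun i _ => hv0 i) (Finset.mem_range.2 hn))
  have hM0 : ∀ j, 0 ≤ ∫ ω, |Y j ω| ^ (2 + δ) ∂μ := fun j =>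
    integral_nonneg fun ω => by positivity
  have key : ∀ ε, 0 < ε → ∀ᶠ n in atTop,
      ‖charFun (μ.map fun ω => (√(V n))⁻¹ * ∑ j ∈ Finset.range n, Y j ω) t -
        Complex.exp (-t ^ 2 / 2)‖ ≤
        4 * (ε * t ^ 2 + ε ^ (-δ) * |t| ^ (2 + δ) * L n) +
          (ε ^ 2 + ε ^ (-δ) * L n) * t ^ 4 / 4 := by
    intro ε hε
    filter_upwards [hVpos] with n hn
    set s := √(V n) with hs
    have hspos : 0 < s := Real.sqrt_pos.2 hn
    have hs2 : s ^ 2 = V n := Real.sq_sqrt hn.le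
    have hsδ : s ^ (2 + δ) = V n ^ (1 + δ / 2) := by
      rw [← hs2, ← Real.rpow_natCast, ← Real.rpow_mul hspos.le]
      congr 1; push_cast; ring
    -- The Gaussian limit is the product of the `exp (-a j)`, and each is compared with one factor
    -- of the characteristic function of the sum.
    set a : ℕ → ℝ := fun j => (s⁻¹ * t) ^ 2 * v j / 2 with ha
    have ha0 : ∀ j, 0 ≤ a j := fun j => by have := hv0 j; positivity
    have hasum : ∑ j ∈ Finset.range n, a j = t ^ 2 / 2 := by
      simp only [ha]
      rw [← Finset.sum_div, ← Finset.mul_sum]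
      change (s⁻¹ * t) ^ 2 * V n / 2 = _
      rw [← hs2]; field_simp
    have hLn : ∀ j ∈ Finset.range n, s ^ (-(2 + δ)) * ∫ ω, |Y j ω| ^ (2 + δ) ∂μ ≤ L n := by
      intro j hj
      simp only [hL]
      rw [← hsδ, Real.rpow_neg hspos.le, inv_mul_eq_div]
      gcongr
      exact Finset.single_le_sum (f := fun j => ∫ ω, |Y j ω| ^ (2 + δ) ∂μ) (fun i _ => hM0 i) hj
    have hamax : ∀ j ∈ Finset.range n, a j ≤ t ^ 2 / 2 * (ε ^ 2 + ε ^ (-δ) * L n) := by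
      intro j hj
      -- Truncating at ε s is truncating the standardised summand at ε.
      have h1 := integral_sq_le_of_integrable_rpow (hY j) (hYδ j) (mul_pos hε hspos) hδ
      rw [← hv] at h1
      have h2 : (s⁻¹) ^ 2 * v j ≤ ε ^ 2 + ε ^ (-δ) * L n := by
        calc (s⁻¹) ^ 2 * v j ≤ (s⁻¹) ^ 2 * ((ε * s) ^ 2 +
              (ε * s) ^ (-δ) * ∫ ω, |Y j ω| ^ (2 + δ) ∂μ) := by gcongr
          _ = ε ^ 2 + ε ^ (-δ) * (s ^ (-(2 + δ)) * ∫ ω, |Y j ω| ^ (2 + δ) ∂μ) := by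
              rw [Real.mul_rpow hε.le hspos.le, neg_add, Real.rpow_add hspos,
                Real.rpow_neg hspos.le 2, Real.rpow_two]
              field_simp
          _ ≤ _ := by have := hLn j hj; gcongr
      calc a j = t ^ 2 / 2 * ((s⁻¹) ^ 2 * v j) := by simp only [ha]; ring
        _ ≤ _ := by gcongr
    have hchar : charFun (μ.map fun ω => s⁻¹ * ∑ j ∈ Finset.range n, Y j ω) t =
        ∏ j ∈ Finset.range n, charFun (μ.map (Y j)) (s⁻¹ * t) := by
      rw [charFun_map_mul_comp (Finset.aemeasurable_fun_sum _ fun _ _ => hm _),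
        (hind.restrict _).charFun_map_fun_finsetSum_eq_prod (fun _ _ => hm _)]
      simp
    have hexp : Complex.exp (-t ^ 2 / 2) = ∏ j ∈ Finset.range n, ((Real.exp (-a j) : ℝ) : ℂ) := by
      rw [← Complex.ofReal_prod, ← Real.exp_sum, Finset.sum_neg_distrib, hasum]
      push_cast; congr 1; ring
    rw [hchar, hexp]
    have : ∀ j, IsProbabilityMeasure (μ.map (Y j)) := fun j =>
      Measure.isProbabilityMeasure_map (hm j)
    refine (norm_prod_sub_prod_le _ _ _ (fun j _ => norm_charFun_le_one _) fun j _ => ?_).trans ?_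
    · rw [Complex.norm_real, Real.norm_of_nonneg (Real.exp_pos _).le, Real.exp_le_one_iff]
      linarith [ha0 j]
    have hterm : ∀ j ∈ Finset.range n,
        ‖charFun (μ.map (Y j)) (s⁻¹ * t) - ((Real.exp (-a j) : ℝ) : ℂ)‖ ≤
          4 * (ε * (s⁻¹ * t) ^ 2 * v j +
            ε ^ (-δ) * |s⁻¹ * t| ^ (2 + δ) * ∫ ω, |Y j ω| ^ (2 + δ) ∂μ) +
          t ^ 2 / 2 * (ε ^ 2 + ε ^ (-δ) * L n) * a j := by
      intro j hj
      have h1 := norm_charFun_map_sub_le (hm j) (hY j) (hYδ j) (h0 j) hε hδ (s⁻¹ * t)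
      rw [← hv] at h1
      have h2 : ‖((1 - (s⁻¹ * t) ^ 2 * v j / 2 : ℝ) : ℂ) - ((Real.exp (-a j) : ℝ) : ℂ)‖ ≤
          a j * a j := by
        rw [norm_sub_rev, ← Complex.ofReal_sub, Complex.norm_real, Real.norm_eq_abs, ← sq]
        exact norm_exp_neg_sub_one_add_le (ha0 j)
      have h3 : a j * a j ≤ t ^ 2 / 2 * (ε ^ 2 + ε ^ (-δ) * L n) * a j :=
        mul_le_mul_of_nonneg_right (hamax j hj) (ha0 j)
      exact (norm_sub_le_norm_sub_add_norm_sub _ _ _).trans (add_le_add h1 (h2.trans h3))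
    refine (Finset.sum_le_sum hterm).trans_eq ?_
    rw [Finset.sum_add_distrib, ← Finset.mul_sum, ← Finset.mul_sum, Finset.sum_add_distrib,
      ← Finset.mul_sum, ← Finset.mul_sum, hasum]
    have e1 : ε * (s⁻¹ * t) ^ 2 * ∑ j ∈ Finset.range n, v j = ε * t ^ 2 := by
      change ε * (s⁻¹ * t) ^ 2 * V n = _
      rw [← hs2]; field_simp
    have e2 : ε ^ (-δ) * |s⁻¹ * t| ^ (2 + δ) * ∑ j ∈ Finset.range n, ∫ ω, |Y j ω| ^ (2 + δ) ∂μ =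
        ε ^ (-δ) * |t| ^ (2 + δ) * L n := by
      simp only [hL]
      rw [← hsδ, abs_mul, abs_of_pos (inv_pos.2 hspos),
        Real.mul_rpow (inv_pos.2 hspos).le (abs_nonneg _), Real.inv_rpow hspos.le]
      ring
    rw [e1, e2]; ring
  rw [tendsto_iff_norm_sub_tendsto_zero, Metric.tendsto_nhds]
  intro η hη
  -- This is what remains of the bound in `key` when n tends to infinity with ε fixed.
  obtain ⟨ε, hε, hεη⟩ : ∃ ε > 0, 4 * (ε * t ^ 2) + ε ^ 2 * t ^ 4 / 4 < η := by
    have hc : Tendsto (fun ε : ℝ => 4 * (ε * t ^ 2) + ε ^ 2 * t ^ 4 / 4) (𝓝[>] 0) (𝓝 0) := by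
      have : Continuous (fun ε : ℝ => 4 * (ε * t ^ 2) + ε ^ 2 * t ^ 4 / 4) := by fun_prop
      simpa using this.continuousWithinAt (s := Set.Ioi 0) (x := 0) |>.tendsto
    obtain ⟨ε, h1, h2⟩ := ((hc.eventually_lt_const hη).and self_mem_nhdsWithin).exists
    exact ⟨ε, h2, h1⟩
  have hlim : Tendsto (fun n => 4 * (ε * t ^ 2 + ε ^ (-δ) * |t| ^ (2 + δ) * L n) +
      (ε ^ 2 + ε ^ (-δ) * L n) * t ^ 4 / 4) atTop
      (𝓝 (4 * (ε * t ^ 2) + ε ^ 2 * t ^ 4 / 4)) := by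
    have := (((hLyap.const_mul (ε ^ (-δ) * |t| ^ (2 + δ))).const_add (ε * t ^ 2)).const_mul 4).add
      ((((hLyap.const_mul (ε ^ (-δ))).const_add (ε ^ 2)).mul_const (t ^ 4)).div_const 4)
    simpa using this
  filter_upwards [key ε hε, hlim.eventually_lt_const hεη] with n h1 h2
  rw [dist_zero_right, norm_norm]
  exact h1.trans_lt h2

/-! ### Asymptotic normality of the gamma law -/

theorem mgf_id_gammaMeasure {a r s : ℝ} (ha : 0 < a) (hr : 0 < r) (hs : s < r) :
    mgf id (gammaMeasure a r) s = (1 - s / r) ^ (-a) := by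
  have hrs : 0 < r - s := sub_pos.2 hs
  have h1 : mgf id (gammaMeasure a r) s = ∫ x, gammaPDFReal a r x * Real.exp (s * x) := by
    rw [mgf, gammaMeasure, integral_withDensity_eq_integral_toReal_smul
      (by unfold gammaPDF; fun_prop) (ae_of_all _ fun x => by simp [gammaPDF])]
    refine integral_congr_ae (ae_of_all _ fun x => ?_)
    simp [gammaPDF, ENNReal.toReal_ofReal (gammaPDFReal_nonneg ha hr x)]
  have h2 : ∫ x, gammaPDFReal a r x * Real.exp (s * x) =
      ∫ x in Set.Ioi 0, r ^ a / Real.Gamma a * (x ^ (a - 1) * Real.exp (-((r - s) * x))) := by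
    rw [← integral_Ici_eq_integral_Ioi, ← integral_indicator measurableSet_Ici]
    refine integral_congr_ae (ae_of_all _ fun x => ?_)
    by_cases hx : 0 ≤ x
    · rw [Set.indicator_of_mem (Set.mem_Ici.2 hx)]
      simp only [gammaPDFReal, if_pos hx]
      rw [mul_assoc, mul_assoc, ← Real.exp_add]
      ring_nf
    · rw [Set.indicator_of_notMem (by simpa using hx)]
      simp [gammaPDFReal, if_neg hx]
  rw [h1, h2, integral_const_mul, Real.integral_rpow_mul_exp_neg_mul_Ioi ha hrs]
  have hG : Real.Gamma a ≠ 0 := (Real.Gamma_pos_of_pos ha).ne'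
  have h3 : 1 - s / r = (r - s) / r := by field_simp
  rw [h3, Real.rpow_neg (by positivity), Real.div_rpow hrs.le hr.le,
    Real.div_rpow zero_le_one hrs.le, Real.one_rpow]
  field_simp

/-- Both sides extend analytically to the half-plane Re z < r and agree on its real points near 0,
so the identity theorem applies at z = it. -/
theorem charFun_gammaMeasure {a r : ℝ} (ha : 0 < a) (hr : 0 < r) (t : ℝ) :
    charFun (gammaMeasure a r) t = (1 - t * Complex.I / r : ℂ) ^ (-a : ℂ) := by
  have := isProbabilityMeasure_gammaMeasure ha hr
  have hsub : Set.Iio r ⊆ interior (integrableExpSet id (gammaMeasure a r)) := by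
    refine interior_maximal (fun s hs => ?_) isOpen_Iio
    -- A non-integrable function has integral 0 by convention, so the nonzero value already found
    -- gives integrability.
    refine Integrable.of_integral_ne_zero ?_
    have h := mgf_id_gammaMeasure ha hr hs
    rw [mgf] at h
    rw [h]
    have : 0 < 1 - s / r := by
      rw [sub_pos, div_lt_one hr]; exact hs
    positivity
  set U : Set ℂ := {z | z.re < r} with hU
  have hUo : IsOpen U := isOpen_lt Complex.continuous_re continuous_const
  have hf : AnalyticOnNhd ℂ (complexMGF id (gammaMeasure a r)) U :=
    fun z hz => analyticAt_complexMGF (hsub hz)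
  have hg : AnalyticOnNhd ℂ (fun z : ℂ => (1 - z / r) ^ (-a : ℂ)) U := by
    refine DifferentiableOn.analyticOnNhd (fun z hz => ?_) hUo
    refine (DifferentiableAt.cpow (by fun_prop) (by fun_prop) (Or.inl ?_)).differentiableWithinAt
    have : (1 - z / r : ℂ).re = 1 - z.re / r := by simp
    rw [this, sub_pos, div_lt_one hr]
    exact hz
  have hconn : IsPreconnected U := (convex_halfSpace_re_lt r).isPreconnected
  have h0 : (0 : ℂ) ∈ U := by simpa [hU] using hr
  have hreal : ∃ᶠ z in 𝓝[≠] (0 : ℂ),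
      complexMGF id (gammaMeasure a r) z = (1 - z / r) ^ (-a : ℂ) := by
    have ht : Tendsto (fun x : ℝ => (x : ℂ)) (𝓝[≠] 0) (𝓝[≠] 0) := by
      refine tendsto_nhdsWithin_iff.2 ⟨?_, ?_⟩
      · exact (Complex.continuous_ofReal.tendsto' 0 0 (by simp)).mono_left nhdsWithin_le_nhds
      · filter_upwards [self_mem_nhdsWithin] with x hx
        simpa using hx
    refine ht.frequently (Eventually.frequently ?_)
    filter_upwards [nhdsWithin_le_nhds (Iio_mem_nhds hr)] with x hx
    have : 0 < 1 - x / r := by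
      rw [sub_pos, div_lt_one hr]; exact hx
    rw [complexMGF_ofReal, mgf_id_gammaMeasure ha hr hx, Complex.ofReal_cpow this.le]
    push_cast; rfl
  have := hf.eqOn_of_preconnected_of_frequently_eq hg hconn h0 hreal
    (show (t * Complex.I : ℂ) ∈ U by simpa [hU] using hr)
  rw [complexMGF_id_mul_I] at this
  simpa using this

/-- To second order, -A² log(1 - it/A) = itA - t²/2. The first term cancels the centering factor,
and the logarithm's remainder `R A` is O(A⁻³), hence negligible after multiplication by A². -/
theorem tendsto_exp_mul_cpow_neg_sq (t : ℝ) :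
    Tendsto (fun A : ℝ => Complex.exp (-(t * A * Complex.I)) *
      (1 - t * Complex.I / A : ℂ) ^ (-(A ^ 2 : ℝ) : ℂ)) atTop
      (𝓝 (Complex.exp (-t ^ 2 / 2))) := by
  set R : ℝ → ℂ := fun A => Complex.log (1 + -(t * Complex.I / A)) -
    Complex.logTaylor 3 (-(t * Complex.I / A)) with hR
  have hRlim : Tendsto (fun A : ℝ => (A : ℂ) ^ 2 * R A) atTop (𝓝 0) := by
    refine squeeze_zero_norm' (a := fun A : ℝ => |t| ^ 3 / A) ?_ (tendsto_id.const_div_atTop (|t| ^ 3))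
    filter_upwards [eventually_gt_atTop 0, eventually_ge_atTop (2 * |t|)] with A hA hAt
    have hw : ‖-(t * Complex.I / A : ℂ)‖ = |t| / A := by simp [abs_of_pos hA]
    have hw2 : |t| / A ≤ 1 / 2 := by rw [div_le_iff₀ hA]; linarith
    have hb := Complex.norm_log_sub_logTaylor_le 2 (z := -(t * Complex.I / A : ℂ))
      (by rw [hw]; linarith)
    rw [hw] at hb
    have hinv : (1 - |t| / A)⁻¹ ≤ 2 := inv_le_of_inv_le₀ (by norm_num) (by linarith)
    have hb2 : ‖R A‖ ≤ (|t| / A) ^ 3 := by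
      refine hb.trans ?_
      have hc : 0 ≤ (|t| / A) ^ 3 := by positivity
      norm_num
      nlinarith
    calc ‖(A : ℂ) ^ 2 * R A‖ = A ^ 2 * ‖R A‖ := by simp
      _ ≤ A ^ 2 * (|t| / A) ^ 3 := by gcongr
      _ = |t| ^ 3 / A := by field_simp
  have hlim : Tendsto (fun A : ℝ => Complex.exp (-t ^ 2 / 2 - (A : ℂ) ^ 2 * R A)) atTop
      (𝓝 (Complex.exp (-t ^ 2 / 2))) := by
    have := (hRlim.const_sub (-(t : ℂ) ^ 2 / 2)).cexp
    simpa using this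
  refine hlim.congr' ?_
  filter_upwards [eventually_gt_atTop 0] with A hA
  have hA' : (A : ℂ) ≠ 0 := by exact_mod_cast hA.ne'
  have hne : (1 - t * Complex.I / A : ℂ) ≠ 0 := by
    intro h
    have := congrArg Complex.re h
    simp at this
  rw [Complex.cpow_def_of_ne_zero hne, ← Complex.exp_add]
  congr 1
  have htaylor : ∀ w : ℂ, Complex.logTaylor 3 w = w - w ^ 2 / 2 := fun w => by
    simp [Complex.logTaylor, Finset.sum_range_succ]
    ring
  simp only [hR, htaylor, ← sub_eq_add_neg]
  push_cast
  field_simp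
  ring_nf
  rw [Complex.I_sq]
  ring

theorem charFun_map_inv_mul_sub {ρ : Measure ℝ} (s M t : ℝ) :
    charFun (ρ.map fun x => s⁻¹ * (x - M)) t =
      Complex.exp (-(t * (M / s) * Complex.I)) * charFun ρ (t / s) := by
  rw [charFun_apply_real, charFun_apply_real, integral_map (by fun_prop) (by fun_prop),
    ← integral_const_mul]
  congr 1; ext x
  rw [← Complex.exp_add]
  congr 1
  push_cast
  ring

/-- These parameters give mean `M n` and variance `s n ^ 2`; the standardised characteristic
function depends on them only through A = `M n / s n`. -/
theorem tendsto_charFun_gammaMeasure {M s : ℕ → ℝ} (hM : ∀ n, 0 < M n) (hs : ∀ n, 0 < s n)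
    (hA : Tendsto (fun n => M n / s n) atTop atTop) (t : ℝ) :
    Tendsto (fun n => charFun ((gammaMeasure (M n ^ 2 / s n ^ 2) (M n / s n ^ 2)).map
      fun x => (s n)⁻¹ * (x - M n)) t) atTop (𝓝 (Complex.exp (-t ^ 2 / 2))) := by
  refine ((tendsto_exp_mul_cpow_neg_sq t).comp hA).congr fun n => ?_
  have h1 := hM n
  have h2 := hs n
  rw [charFun_map_inv_mul_sub, charFun_gammaMeasure (by positivity) (by positivity)]
  have h1' : (M n : ℂ) ≠ 0 := by exact_mod_cast h1.ne'
  have h2' : (s n : ℂ) ≠ 0 := by exact_mod_cast h2.ne'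
  simp only [Function.comp]
  push_cast
  congr 2
  · field_simp
  · rw [div_pow]

/-! ### Quantiles and the normal limit -/

/-- With Φ z = p, strict monotonicity traps the quantile between c + s(z - d) and c + s(z + d) for
large n; continuity of Φ then lets d shrink to 0. -/
theorem tendsto_measureReal_lt_sInf {Ω : Type*} [MeasurableSpace Ω] {μ : Measure Ω}
    [IsFiniteMeasure μ] {S : ℕ → Ω → ℝ} {G : ℕ → ℝ → ℝ} (hGmono : ∀ n, Monotone (G n))
    {Φ : ℝ → ℝ} (hΦc : Continuous Φ) (hΦm : StrictMono Φ) (hΦbot : Tendsto Φ atBot (𝓝 0))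
    (hΦtop : Tendsto Φ atTop (𝓝 1)) {c s : ℕ → ℝ}
    (hS : ∀ z, Tendsto (fun n => μ.real {ω | S n ω < c n + s n * z}) atTop (𝓝 (Φ z)))
    (hG : ∀ z, Tendsto (fun n => G n (c n + s n * z)) atTop (𝓝 (Φ z)))
    {p : ℝ} (hp0 : 0 < p) (hp1 : p < 1) :
    Tendsto (fun n => μ.real {ω | S n ω < sInf {x | p ≤ G n x}}) atTop (𝓝 p) := by
  obtain ⟨z, rfl⟩ : ∃ z, Φ z = p := by
    obtain ⟨a, ha⟩ := (hΦbot.eventually_lt_const hp0).exists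
    obtain ⟨b, hb⟩ := (hΦtop.eventually_const_lt hp1).exists
    exact mem_range_of_exists_le_of_exists_ge hΦc ⟨a, ha.le⟩ ⟨b, hb.le⟩
  have hbounds : ∀ d > 0, ∀ᶠ n in atTop,
      c n + s n * (z - d) ≤ sInf {x | Φ z ≤ G n x} ∧
        sInf {x | Φ z ≤ G n x} ≤ c n + s n * (z + d) := by
    intro d hd
    have h1 : Φ (z - d) < Φ z := hΦm (by linarith)
    have h2 : Φ z < Φ (z + d) := hΦm (by linarith)
    filter_upwards [(hG (z - d)).eventually_lt_const h1, (hG (z + d)).eventually_const_lt h2]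
      with n hn1 hn2
    have hlb : ∀ x ∈ {x | Φ z ≤ G n x}, c n + s n * (z - d) ≤ x := by
      intro x hx
      by_contra! hlt
      exact absurd (hx.trans (hGmono n hlt.le)) (not_le.2 hn1)
    exact ⟨le_csInf ⟨_, hn2.le⟩ hlb, csInf_le ⟨_, hlb⟩ hn2.le⟩
  have hmono : ∀ n, Monotone fun x => μ.real {ω | S n ω < x} := fun n x y hxy =>
    measureReal_mono fun ω hω => lt_of_lt_of_le hω hxy
  rw [tendsto_order]
  constructor
  · intro a ha
    obtain ⟨d, hd, had⟩ : ∃ d > 0, a < Φ (z - d) := by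
      have hc : Tendsto (fun d => Φ (z - d)) (𝓝[>] 0) (𝓝 (Φ z)) :=
        ((hΦc.comp (continuous_const.sub continuous_id)).tendsto' 0 _ (by simp)).mono_left
          nhdsWithin_le_nhds
      obtain ⟨d, h1, h2⟩ := ((hc.eventually_const_lt ha).and self_mem_nhdsWithin).exists
      exact ⟨d, h2, h1⟩
    filter_upwards [hbounds d hd, (hS (z - d)).eventually_const_lt had] with n h1 h2
    exact h2.trans_le (hmono n h1.1)
  · intro a ha
    obtain ⟨d, hd, had⟩ : ∃ d > 0, Φ (z + d) < a := by
      have hc : Tendsto (fun d => Φ (z + d)) (𝓝[>] 0) (𝓝 (Φ z)) :=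
        ((hΦc.comp (continuous_const.add continuous_id)).tendsto' 0 _ (by simp)).mono_left
          nhdsWithin_le_nhds
      obtain ⟨d, h1, h2⟩ := ((hc.eventually_lt_const ha).and self_mem_nhdsWithin).exists
      exact ⟨d, h2, h1⟩
    filter_upwards [hbounds d hd, (hS (z + d)).eventually_lt_const had] with n h1 h2
    exact (hmono n h1.2).trans_lt h2

theorem strictMono_cdf_gaussianReal : StrictMono (cdf (gaussianReal 0 1)) := by
  intro x y hxy
  rw [cdf_eq_real, cdf_eq_real, ← Set.Iic_union_Ioc_eq_Iic hxy.le,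
    measureReal_union (Set.Iic_disjoint_Ioc le_rfl) measurableSet_Ioc, lt_add_iff_pos_right,
    measureReal_def, ENNReal.toReal_pos_iff]
  refine ⟨pos_iff_ne_zero.2 fun h => ?_, measure_lt_top _ _⟩
  have := gaussianReal_absolutelyContinuous' 0 (one_ne_zero (α := NNReal)) h
  simp only [Real.volume_Ioc, ENNReal.ofReal_eq_zero] at this
  linarith

theorem continuous_cdf_gaussianReal : Continuous (cdf (gaussianReal 0 1)) := by
  have : NullSingletonClass (gaussianReal 0 1) := nullSingletonClass_gaussianReal one_ne_zero
  refine continuous_iff_continuousAt.2 fun x => ?_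
  rw [(monotone_cdf _).continuousAt_iff_leftLim_eq_rightLim, StieltjesFunction.rightLim_eq]
  refine le_antisymm ((monotone_cdf _).leftLim_le le_rfl) ?_
  have h := StieltjesFunction.measure_singleton (cdf (gaussianReal 0 1)) x
  rw [measure_cdf, measure_singleton, eq_comm, ENNReal.ofReal_eq_zero] at h
  linarith

/-- Lévy's continuity theorem, then the portmanteau theorem, the Gaussian having no atoms. The
closed half-line serves the gamma distribution function, the open one the strict inequality for the
sums. -/
theorem tendsto_measureReal_Iic_of_tendsto_charFun {P : ℕ → Measure ℝ}
    [∀ n, IsProbabilityMeasure (P n)]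
    (h : ∀ t, Tendsto (fun n => charFun (P n) t) atTop (𝓝 (Complex.exp (-t ^ 2 / 2)))) (z : ℝ) :
    Tendsto (fun n => (P n).real (Set.Iic z)) atTop (𝓝 (cdf (gaussianReal 0 1) z)) ∧
      Tendsto (fun n => (P n).real (Set.Iio z)) atTop (𝓝 (cdf (gaussianReal 0 1) z)) := by
  have : NullSingletonClass (gaussianReal 0 1) := nullSingletonClass_gaussianReal one_ne_zero
  let Q : ℕ → ProbabilityMeasure ℝ := fun n => ⟨P n, inferInstance⟩
  let γ : ProbabilityMeasure ℝ := ⟨gaussianReal 0 1, inferInstance⟩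
  have hlim : Tendsto Q atTop (𝓝 γ) := by
    refine ProbabilityMeasure.tendsto_iff_tendsto_charFun.2 fun t => ?_
    simpa [Q, γ, charFun_gaussianReal, neg_div] using h t
  rw [cdf_eq_real]
  constructor
  · exact (ENNReal.tendsto_toReal (measure_ne_top _ _)).comp
      (ProbabilityMeasure.tendsto_measure_of_null_frontier_of_tendsto' hlim
        (E := Set.Iic z) (by simp [γ]))
  · rw [measureReal_congr (Iio_ae_eq_Iic (μ := gaussianReal 0 1)).symm]
    exact (ENNReal.tendsto_toReal (measure_ne_top _ _)).comp
      (ProbabilityMeasure.tendsto_measure_of_null_frontier_of_tendsto' hlim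
        (E := Set.Iio z) (by simp [γ]))

/-! ### Uniform bounds on the scores of a discrete law -/

theorem meanValueChiSq_eq {ρ : Measure ℝ} (x : ℝ) : meanValueChiSq ρ x =
    (-2 * (ρ.real (Set.Iic x) * Real.log (ρ.real (Set.Iic x)) -
      ρ.real (Set.Iio x) * Real.log (ρ.real (Set.Iio x)) -
      ρ.real (Set.Iic x) + ρ.real (Set.Iio x))) /
    (ρ.real (Set.Iic x) - ρ.real (Set.Iio x)) := by
  rw [meanValueChiSq, intervalIntegral.integral_const_mul, integral_log]

theorem exp_div_four_le {ρ : Measure ℝ} {h : ℝ → ℝ}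
    (hle : ∀ x, h x ≤ 2 - 2 * Real.log (ρ.real (Set.Iic x)))
    (x : ℝ) :
    Real.exp (h x / 4) ≤
      Real.exp (1 / 2) * Real.exp (-Real.log (ρ.real (Set.Iic x)) / 2) := by
  rw [← Real.exp_add, Real.exp_le_exp]
  linarith [hle x]

section Discrete

variable {ρ : Measure ℝ} [IsProbabilityMeasure ρ]

theorem measurable_real_Iic : Measurable fun x => ρ.real (Set.Iic x) :=
  Monotone.measurable fun _ _ h => measureReal_mono (Set.Iic_subset_Iic.2 h)

theorem measurable_real_Iio : Measurable fun x => ρ.real (Set.Iio x) :=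
  Monotone.measurable fun _ _ h => measureReal_mono (Set.Iio_subset_Iio h)

theorem real_Iio_le_real_Iic (x : ℝ) : ρ.real (Set.Iio x) ≤ ρ.real (Set.Iic x) :=
  measureReal_mono Set.Iio_subset_Iic_self

theorem measure_singleton_eq_ofReal_sub (x : ℝ) :
    ρ {x} = ENNReal.ofReal (ρ.real (Set.Iic x) - ρ.real (Set.Iio x)) := by
  rw [← measureReal_sdiff Set.Iio_subset_Iic_self measurableSet_Iio, Set.Iic_sdiff_Iio,
    Set.Icc_self, ofReal_measureReal]

/-- The intervals from F₋(x) to F(x) are disjoint, with lengths the masses of the atoms. These sum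
to 1, so the intervals fill (0, 1] up to a null set. -/
theorem lintegral_eq_of_mul_singleton_eq {s : Set ℝ} (hs : s.Countable) (hρ : ∀ᵐ x ∂ρ, x ∈ s)
    {f g : ℝ → ENNReal}
    (h : ∀ x, f x * ρ {x} =
      ∫⁻ u in Set.Ioc (ρ.real (Set.Iio x)) (ρ.real (Set.Iic x)), g u) :
    ∫⁻ x, f x ∂ρ = ∫⁻ u in Set.Ioc 0 1, g u := by
  have hcount := hs.to_subtype
  have h1 : ∀ f : ℝ → ENNReal, ∫⁻ x, f x ∂ρ = ∑' x : s, f x * ρ {(x : ℝ)} := fun f => by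
    rw [← lintegral_countable f hs, Measure.restrict_eq_self_of_ae_mem hρ]
  set I : s → Set ℝ := fun x => Set.Ioc (ρ.real (Set.Iio (x : ℝ))) (ρ.real (Set.Iic (x : ℝ)))
    with hI
  have hdisj : Pairwise (Function.onFun Disjoint I) := by
    refine (pairwise_disjoint_on I).2 fun x y hxy => ?_
    have : ρ.real (Set.Iic (x : ℝ)) ≤ ρ.real (Set.Iio (y : ℝ)) :=
      measureReal_mono (Set.Iic_subset_Iio.2 hxy)
    exact Set.Ioc_disjoint_Ioc_of_le this
  have hvol : volume (⋃ x, I x) = 1 := by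
    rw [measure_iUnion hdisj fun x => measurableSet_Ioc]
    have := h1 1
    simp only [Pi.one_apply, lintegral_const, measure_univ, one_mul] at this
    rw [this]
    exact tsum_congr fun x => by rw [measure_singleton_eq_ofReal_sub, Real.volume_Ioc]
  have hsub : (⋃ x, I x) ⊆ Set.Ioc 0 1 :=
    Set.iUnion_subset fun x => Set.Ioc_subset_Ioc measureReal_nonneg measureReal_le_one
  have hae : (⋃ x, I x) =ᵐ[volume] Set.Ioc (0 : ℝ) 1 :=
    ae_eq_of_subset_of_measure_ge hsub (by rw [hvol]; simp)
      (MeasurableSet.iUnion fun x => measurableSet_Ioc).nullMeasurableSet (by simp)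
  rw [h1, ← setLIntegral_congr hae, lintegral_iUnion (fun x => measurableSet_Ioc) hdisj]
  exact tsum_congr fun x => h x

theorem lintegral_le_of_mul_singleton_le {s : Set ℝ} (hs : s.Countable) (hρ : ∀ᵐ x ∂ρ, x ∈ s)
    {f g : ℝ → ENNReal}
    (h : ∀ x, f x * ρ {x} ≤
      ∫⁻ u in Set.Ioc (ρ.real (Set.Iio x)) (ρ.real (Set.Iic x)), g u) :
    ∫⁻ x, f x ∂ρ ≤ ∫⁻ u in Set.Ioc 0 1, g u := by
  set f' : ℝ → ENNReal := fun x =>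
    (∫⁻ u in Set.Ioc (ρ.real (Set.Iio x)) (ρ.real (Set.Iic x)), g u) / ρ {x}
  have hf' : ∀ x, f' x * ρ {x} =
      ∫⁻ u in Set.Ioc (ρ.real (Set.Iio x)) (ρ.real (Set.Iic x)), g u := fun x => by
    refine ENNReal.div_mul_cancel' (fun h0 => ?_) fun h => absurd h (measure_ne_top _ _)
    rw [measure_singleton_eq_ofReal_sub, ENNReal.ofReal_eq_zero] at h0
    rw [Set.Ioc_eq_empty (by linarith)]
    simp
  rw [← lintegral_eq_of_mul_singleton_eq hs hρ hf', ← Measure.restrict_eq_self_of_ae_mem hρ,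
    lintegral_countable f hs, lintegral_countable f' hs]
  exact ENNReal.tsum_le_tsum fun x => (h x).trans_eq (hf' x).symm

theorem measurable_meanValueChiSq : Measurable (meanValueChiSq ρ) := by
  have h1 := measurable_real_Iic (ρ := ρ)
  have h2 := measurable_real_Iio (ρ := ρ)
  rw [funext (meanValueChiSq_eq (ρ := ρ))]
  fun_prop

theorem measurable_medianValueChiSq : Measurable (medianValueChiSq ρ) := by
  have h1 := measurable_real_Iic (ρ := ρ)
  have h2 := measurable_real_Iio (ρ := ρ)
  unfold medianValueChiSq
  fun_prop

theorem meanValueChiSq_nonneg (x : ℝ) : 0 ≤ meanValueChiSq ρ x := by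
  refine div_nonneg (intervalIntegral.integral_nonneg (real_Iio_le_real_Iic x) fun u hu => ?_)
    (sub_nonneg.2 (real_Iio_le_real_Iic x))
  have := Real.log_nonpos (measureReal_nonneg.trans hu.1) (hu.2.trans measureReal_le_one)
  linarith

theorem medianValueChiSq_nonneg (x : ℝ) : 0 ≤ medianValueChiSq ρ x := by
  have h1 := real_Iio_le_real_Iic (ρ := ρ) x
  have h2 : ρ.real (Set.Iic x) ≤ 1 := measureReal_le_one
  have h3 : 0 ≤ ρ.real (Set.Iio x) := measureReal_nonneg
  have := Real.log_nonpos (x := (ρ.real (Set.Iic x) + ρ.real (Set.Iio x)) / 2)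
    (by linarith) (by linarith)
  unfold medianValueChiSq
  linarith

theorem meanValueChiSq_le (x : ℝ) :
    meanValueChiSq ρ x ≤ 2 - 2 * Real.log (ρ.real (Set.Iic x)) := by
  rw [meanValueChiSq_eq]
  have h1 := real_Iio_le_real_Iic (ρ := ρ) x
  have h2 : ρ.real (Set.Iic x) ≤ 1 := measureReal_le_one
  have h3 : 0 ≤ ρ.real (Set.Iio x) := measureReal_nonneg
  set a := ρ.real (Set.Iio x)
  set b := ρ.real (Set.Iic x)
  -- Off the atoms the score is a quotient by 0, hence 0.
  rcases h1.eq_or_lt with h | h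
  · have := Real.log_nonpos (h3.trans h1) h2
    rw [sub_eq_zero.2 h.symm, div_zero]
    linarith
  · rw [div_le_iff₀ (sub_pos.2 h)]
    have : a * Real.log a ≤ a * Real.log b := by
      rcases h3.eq_or_lt with h0 | h0
      · simp [← h0]
      · exact mul_le_mul_of_nonneg_left (Real.log_le_log h0 h1) h3
    nlinarith

theorem medianValueChiSq_le (x : ℝ) :
    medianValueChiSq ρ x ≤ 2 - 2 * Real.log (ρ.real (Set.Iic x)) := by
  unfold medianValueChiSq
  have h1 := real_Iio_le_real_Iic (ρ := ρ) x
  have h3 : 0 ≤ ρ.real (Set.Iio x) := measureReal_nonneg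
  set a := ρ.real (Set.Iio x)
  set b := ρ.real (Set.Iic x)
  rcases (h3.trans h1).eq_or_lt with h | h
  · have : a = 0 := le_antisymm (h ▸ h1) h3
    simp [← h, this]
  · have h4 : Real.log (b / 2) ≤ Real.log ((b + a) / 2) :=
      Real.log_le_log (by linarith) (by linarith)
    rw [Real.log_div h.ne' (by norm_num)] at h4
    -- Halving F costs 2 log 2, which is less than 2.
    have := Real.log_two_lt_d9
    linarith

theorem integral_meanValueChiSq {s : Set ℝ} (hs : s.Countable) (hρ : ∀ᵐ x ∂ρ, x ∈ s) :
    ∫ x, meanValueChiSq ρ x ∂ρ = 2 := by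
  have hint : ∀ a b : ℝ, IntervalIntegrable (fun u => -2 * Real.log u) volume a b :=
    fun a b => intervalIntegral.intervalIntegrable_log'.const_mul _
  have hkey : ∀ a b : ℝ, 0 ≤ a → a ≤ b → b ≤ 1 →
      ENNReal.ofReal (∫ u in a..b, -2 * Real.log u) =
        ∫⁻ u in Set.Ioc a b, ENNReal.ofReal (-2 * Real.log u) := fun a b h0 h h1 => by
    rw [intervalIntegral.integral_of_le h]
    refine ofReal_integral_eq_lintegral_ofReal (hint a b).1 ?_
    filter_upwards [ae_restrict_mem measurableSet_Ioc] with u hu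
    have := Real.log_nonpos (h0.trans hu.1.le) (hu.2.trans h1)
    simp only [Pi.zero_apply]
    linarith
  rw [integral_eq_lintegral_of_nonneg_ae (ae_of_all _ meanValueChiSq_nonneg)
    measurable_meanValueChiSq.aestronglyMeasurable,
    lintegral_eq_of_mul_singleton_eq hs hρ (g := fun u => ENNReal.ofReal (-2 * Real.log u)),
    ← hkey 0 1 le_rfl zero_le_one le_rfl]
  · simp
  · intro x
    rw [← hkey _ _ measureReal_nonneg (real_Iio_le_real_Iic x) measureReal_le_one,
      measure_singleton_eq_ofReal_sub, ← ENNReal.ofReal_mul (meanValueChiSq_nonneg x),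
      meanValueChiSq]
    rcases (real_Iio_le_real_Iic (ρ := ρ) x).eq_or_lt with h | h
    · simp [h]
    · rw [div_mul_cancel₀ _ (sub_pos.2 h).ne']

theorem integral_midpoint {s : Set ℝ} (hs : s.Countable) (hρ : ∀ᵐ x ∂ρ, x ∈ s) :
    ∫ x, (ρ.real (Set.Iic x) + ρ.real (Set.Iio x)) / 2 ∂ρ = 1 / 2 := by
  have hkey : ∀ a b : ℝ, 0 ≤ a → a ≤ b →
      ENNReal.ofReal (∫ u in a..b, u) = ∫⁻ u in Set.Ioc a b, ENNReal.ofReal u := fun a b h0 h => by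
    rw [intervalIntegral.integral_of_le h]
    refine ofReal_integral_eq_lintegral_ofReal
      (intervalIntegral.intervalIntegrable_id (μ := volume)).1 ?_
    filter_upwards [ae_restrict_mem measurableSet_Ioc] with u hu
    exact h0.trans hu.1.le
  have hnn : ∀ x, 0 ≤ (ρ.real (Set.Iic x) + ρ.real (Set.Iio x)) / 2 := fun x => by positivity
  have h1 := measurable_real_Iic (ρ := ρ)
  have h2 := measurable_real_Iio (ρ := ρ)
  rw [integral_eq_lintegral_of_nonneg_ae (ae_of_all _ hnn) (by fun_prop),
    lintegral_eq_of_mul_singleton_eq hs hρ (g := fun u => ENNReal.ofReal u),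
    ← hkey 0 1 le_rfl zero_le_one]
  · simp
  · intro x
    rw [← hkey _ _ measureReal_nonneg (real_Iio_le_real_Iic x),
      measure_singleton_eq_ofReal_sub, ← ENNReal.ofReal_mul (hnn x), integral_id]
    congr 1; ring

/-- On the interval attached to x one has u ≤ F(x), so F(x)^(-1/2) ≤ u^(-1/2), and u^(-1/2) has
integral 2 over (0, 1]. -/
theorem lintegral_exp_neg_log_le {s : Set ℝ} (hs : s.Countable) (hρ : ∀ᵐ x ∂ρ, x ∈ s) :
    ∫⁻ x, ENNReal.ofReal (Real.exp (-Real.log (ρ.real (Set.Iic x)) / 2)) ∂ρ ≤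
      ENNReal.ofReal 2 := by
  refine (lintegral_le_of_mul_singleton_le hs hρ
    (g := fun u => ENNReal.ofReal (u ^ (-1 / 2 : ℝ))) fun x => ?_).trans_eq ?_
  · rw [measure_singleton_eq_ofReal_sub, ← Real.volume_Ioc, ← setLIntegral_const]
    refine setLIntegral_mono' measurableSet_Ioc fun u hu => ENNReal.ofReal_le_ofReal ?_
    have hu0 : 0 < u := measureReal_nonneg.trans_lt hu.1
    rw [Real.rpow_def_of_pos hu0, Real.exp_le_exp]
    linarith [Real.log_le_log hu0 hu.2]
  · rw [← ofReal_integral_eq_lintegral_ofReal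
      (intervalIntegral.intervalIntegrable_rpow' (by norm_num) (a := 0) (b := 1)).1,
      ← intervalIntegral.integral_of_le zero_le_one, integral_rpow (Or.inl (by norm_num))]
    · norm_num
    · filter_upwards [ae_restrict_mem measurableSet_Ioc] with u hu
      exact Real.rpow_nonneg hu.1.le _

theorem integrable_exp_neg_log {s : Set ℝ} (hs : s.Countable) (hρ : ∀ᵐ x ∂ρ, x ∈ s) :
    Integrable (fun x => Real.exp (-Real.log (ρ.real (Set.Iic x)) / 2)) ρ := by
  have h1 := measurable_real_Iic (ρ := ρ)
  refine ⟨(by fun_prop : Measurable _).aestronglyMeasurable, ?_⟩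
  rw [hasFiniteIntegral_iff_ofReal (ae_of_all _ fun x => (Real.exp_pos _).le)]
  exact (lintegral_exp_neg_log_le hs hρ).trans_lt ENNReal.ofReal_lt_top

theorem integral_exp_neg_log_le {s : Set ℝ} (hs : s.Countable) (hρ : ∀ᵐ x ∂ρ, x ∈ s) :
    ∫ x, Real.exp (-Real.log (ρ.real (Set.Iic x)) / 2) ∂ρ ≤ 2 := by
  rw [integral_eq_lintegral_of_nonneg_ae (ae_of_all _ fun x => (Real.exp_pos _).le)
    (integrable_exp_neg_log hs hρ).1]
  exact ENNReal.toReal_le_of_le_ofReal (by norm_num) (lintegral_exp_neg_log_le hs hρ)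

variable {h : ℝ → ℝ}

theorem integrable_abs_sub_rpow {s : Set ℝ} (hs : s.Countable) (hρ : ∀ᵐ x ∂ρ, x ∈ s)
    (hm : Measurable h) (h0 : ∀ x, 0 ≤ h x)
    (hle : ∀ x, h x ≤ 2 - 2 * Real.log (ρ.real (Set.Iic x))) (c : ℝ) {q : ℝ} (hq : 0 ≤ q) :
    Integrable (fun x => |h x - c| ^ q) ρ := by
  refine integrable_rpow_abs_of_integrable_exp_mul (t := 1 / 4) (by norm_num) ?_ ?_ hq
  · refine (((integrable_exp_neg_log hs hρ).const_mul (Real.exp (1 / 2))).const_mul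
      (Real.exp (-c / 4))).mono' (by fun_prop) (ae_of_all _ fun x => ?_)
    rw [Real.norm_of_nonneg (Real.exp_pos _).le]
    have e : (1 / 4 * (h x - c)) = -c / 4 + h x / 4 := by ring
    rw [e, Real.exp_add]
    exact mul_le_mul_of_nonneg_left (exp_div_four_le hle x) (Real.exp_pos _).le
  · refine Integrable.of_bound (C := Real.exp (c / 4)) (by fun_prop) (ae_of_all _ fun x => ?_)
    rw [Real.norm_of_nonneg (Real.exp_pos _).le, Real.exp_le_exp]
    linarith [h0 x]

theorem integral_sq_le {s : Set ℝ} (hs : s.Countable) (hρ : ∀ᵐ x ∂ρ, x ∈ s)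
    (h0 : ∀ x, 0 ≤ h x) (hle : ∀ x, h x ≤ 2 - 2 * Real.log (ρ.real (Set.Iic x))) :
    ∫ x, h x ^ 2 ∂ρ ≤ 64 * Real.exp (1 / 2) := by
  have hI := integrable_exp_neg_log hs hρ
  calc ∫ x, h x ^ 2 ∂ρ
      ≤ ∫ x, 32 * Real.exp (1 / 2) * Real.exp (-Real.log (ρ.real (Set.Iic x)) / 2) ∂ρ := by
        refine integral_mono_of_nonneg (ae_of_all _ fun x => sq_nonneg _) (hI.const_mul _)
          (ae_of_all _ fun x => ?_)
        -- The quadratic term (h/4)²/2 gives h² ≤ 32 exp(h/4).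
        have h1 := Real.quadratic_le_exp_of_nonneg (x := h x / 4) (by linarith [h0 x])
        have h2 := exp_div_four_le hle x
        simp only
        nlinarith [h0 x]
    _ = 32 * Real.exp (1 / 2) * ∫ x, Real.exp (-Real.log (ρ.real (Set.Iic x)) / 2) ∂ρ :=
        integral_const_mul _ _
    _ ≤ 32 * Real.exp (1 / 2) * 2 := by
        gcongr
        exact integral_exp_neg_log_le hs hρ
    _ = _ := by ring

theorem one_le_integral_medianValueChiSq {s : Set ℝ} (hs : s.Countable) (hρ : ∀ᵐ x ∂ρ, x ∈ s) :
    1 ≤ ∫ x, medianValueChiSq ρ x ∂ρ := by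
  have h1 := measurable_real_Iic (ρ := ρ)
  have h2 := measurable_real_Iio (ρ := ρ)
  have hmid : Integrable (fun x => (ρ.real (Set.Iic x) + ρ.real (Set.Iio x)) / 2) ρ :=
    Integrable.of_integral_ne_zero (by rw [integral_midpoint hs hρ]; norm_num)
  have hint : Integrable (medianValueChiSq ρ) ρ := by
    have := integrable_abs_sub_rpow hs hρ measurable_medianValueChiSq medianValueChiSq_nonneg
      medianValueChiSq_le 0 zero_le_one
    simp only [Real.rpow_one, sub_zero] at this
    exact this.congr (ae_of_all _ fun x => abs_of_nonneg (medianValueChiSq_nonneg x))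
  -- Where F = 0 the convention log 0 = 0 makes the score 0, and the tangent-line bound below would
  -- fail.
  have hpos : ∀ᵐ x ∂ρ, 0 < ρ.real (Set.Iic x) := by
    have hatom : ∀ᵐ x ∂ρ, x ∉ {x ∈ s | ρ {x} = 0} := by
      refine measure_eq_zero_iff_ae_notMem.1 ?_
      rw [← Set.biUnion_of_singleton {x ∈ s | ρ {x} = 0}]
      exact (measure_biUnion_null_iff (hs.mono (Set.sep_subset _ _))).2 fun x hx => hx.2
    filter_upwards [hatom, hρ] with x hx hxs
    refine measureReal_nonneg.lt_of_ne fun h => hx ⟨hxs, ?_⟩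
    exact measure_mono_null (Set.singleton_subset_iff.2 (Set.mem_Iic.2 le_rfl))
      ((measureReal_eq_zero_iff (measure_ne_top _ _)).1 h.symm)
  calc (1 : ℝ) = ∫ x, 2 * (1 - (ρ.real (Set.Iic x) + ρ.real (Set.Iio x)) / 2) ∂ρ := by
        rw [integral_const_mul, integral_sub (integrable_const _) hmid, integral_midpoint hs hρ]
        simp; norm_num
    _ ≤ _ := by
        refine integral_mono_ae (((integrable_const _).sub hmid).const_mul _) hint ?_
        filter_upwards [hpos] with x hx
        have h3 : 0 ≤ ρ.real (Set.Iio x) := measureReal_nonneg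
        have := Real.log_le_sub_one_of_pos
          (x := (ρ.real (Set.Iic x) + ρ.real (Set.Iio x)) / 2) (by linarith)
        simp only [medianValueChiSq]
        linarith

end Discrete

/-! ### The limit for scores with means at least 1 and bounded variances -/

theorem tendsto_measureReal_sum_lt_gammaQuantile {Ω : Type*} [MeasurableSpace Ω] {μ : Measure Ω}
    [IsProbabilityMeasure μ] {Z : ℕ → Ω → ℝ} {m v : ℕ → ℝ} {δ C : ℝ} (hδ : 0 < δ)
    (hZ : ∀ j, MemLp (Z j) 2 μ) (hZδ : ∀ j, Integrable (fun ω => |Z j ω - m j| ^ (2 + δ)) μ)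
    (hind : iIndepFun Z μ) (hm : ∀ j, m j = ∫ ω, Z j ω ∂μ)
    (hv : ∀ j, v j = variance (Z j) μ) (hm1 : ∀ j, 1 ≤ m j) (hvC : ∀ j, v j ≤ C)
    (hvpos : ∃ j, 0 < v j)
    (hLyap : Tendsto (fun n : ℕ =>
      (∑ j ∈ Finset.range n, ∫ ω, |Z j ω - m j| ^ (2 + δ) ∂μ) /
        (∑ j ∈ Finset.range n, v j) ^ (1 + δ / 2)) atTop (𝓝 0))
    {p : ℝ} (hp0 : 0 < p) (hp1 : p < 1) :
    Tendsto (fun n : ℕ => μ.real {ω | ∑ j ∈ Finset.range n, Z j ω <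
      gammaQuantile p (n * avg m n ^ 2 / avg v n) (avg v n / avg m n)}) atTop (𝓝 p) := by
  set V : ℕ → ℝ := fun n => ∑ j ∈ Finset.range n, v j with hV
  set M : ℕ → ℝ := fun n => ∑ j ∈ Finset.range n, m j with hM
  have hv0 : ∀ j, 0 ≤ v j := fun j => by rw [hv]; exact variance_nonneg _ _
  obtain ⟨N, hVpos⟩ : ∃ N, ∀ n ≥ N, 0 < V n := by
    obtain ⟨j, hj⟩ := hvpos
    exact ⟨j + 1, fun n hn =>
      hj.trans_le (Finset.single_le_sum (f := v) (fun i _ => hv0 i) (Finset.mem_range.2 hn))⟩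
  have hnM : ∀ n : ℕ, (n : ℝ) ≤ M n := fun n => by
    have := Finset.card_nsmul_le_sum (Finset.range n) m 1 fun j _ => hm1 j
    simpa using this
  have hVn : ∀ n : ℕ, V n ≤ C * n := fun n => by
    have := Finset.sum_le_card_nsmul (Finset.range n) v C fun j _ => hvC j
    simpa [mul_comm] using this
  have hCpos : 0 < C := by
    obtain ⟨j, hj⟩ := hvpos
    exact hj.trans_le (hvC j)
  have hnpos : ∀ n ≥ N, 0 < (n : ℝ) := fun n hn => by
    by_contra! h
    nlinarith [hVpos n hn, hVn n]
  have hMpos : ∀ n ≥ N, 0 < M n := fun n hn => (hnpos n hn).trans_le (hnM n)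
  -- From M ≥ n and V ≤ C n, the ratio is at least √n / √C.
  have hratio : Tendsto (fun n => M n / √(V n)) atTop atTop := by
    have hlow : Tendsto (fun n : ℕ => √(n : ℝ) / √C) atTop atTop :=
      (Real.tendsto_sqrt_atTop.comp tendsto_natCast_atTop_atTop).atTop_div_const
        (Real.sqrt_pos.2 hCpos)
    refine tendsto_atTop_mono' _ ?_ hlow
    filter_upwards [eventually_ge_atTop N] with n hn
    have hn0 := hnpos n hn
    rw [div_le_div_iff₀ (Real.sqrt_pos.2 hCpos) (Real.sqrt_pos.2 (hVpos n hn))]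
    calc √(n : ℝ) * √(V n) ≤ √(n : ℝ) * √(C * n) := by gcongr; exact hVn n
      _ = n * √C := by
        rw [Real.sqrt_mul hCpos.le, mul_left_comm, Real.mul_self_sqrt hn0.le, mul_comm]
      _ ≤ M n * √C := by gcongr; exact hnM n
  refine tendsto_measureReal_lt_sInf
    (G := fun n => cdf (gammaMeasure (n * avg m n ^ 2 / avg v n) (avg v n / avg m n)⁻¹))
    (fun n => monotone_cdf _) continuous_cdf_gaussianReal strictMono_cdf_gaussianReal
    (tendsto_cdf_atBot _) (tendsto_cdf_atTop _) (c := M) (s := fun n => √(V n)) ?_ ?_ hp0 hp1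
  · intro z
    have hYm : ∀ j, AEMeasurable (fun ω => Z j ω - m j) μ := fun j =>
      (hZ j).1.aemeasurable.sub_const _
    have hsq : ∀ j, Integrable (fun ω => (Z j ω - m j) ^ 2) μ := fun j =>
      ((hZ j).sub (memLp_const (m j))).integrable_sq
    have hchar := tendsto_charFun_sum_of_lyapunov (Y := fun j ω => Z j ω - m j) hδ hYm hsq hZδ
      (fun j => by
        rw [integral_sub ((hZ j).integrable (by norm_num)) (integrable_const _), ← hm]; simp)
      (hind.comp (fun j x => x - m j) fun j => by fun_prop)
      (fun j => by rw [hv, variance_eq_integral (hZ j).1.aemeasurable, ← hm]) hvpos hLyap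
    have hsum : ∀ n, AEMeasurable
        (fun ω => (√(V n))⁻¹ * ∑ j ∈ Finset.range n, (Z j ω - m j)) μ := fun n =>
      (Finset.aemeasurable_fun_sum _ fun j _ => hYm j).const_mul _
    have hprob : ∀ n, IsProbabilityMeasure
        (μ.map fun ω => (√(V n))⁻¹ * ∑ j ∈ Finset.range n, (Z j ω - m j)) := fun n =>
      Measure.isProbabilityMeasure_map (hsum n)
    refine (tendsto_measureReal_Iic_of_tendsto_charFun hchar z).2.congr' ?_
    filter_upwards [eventually_ge_atTop N] with n hn
    rw [map_measureReal_apply_of_aemeasurable (hsum n) measurableSet_Iio]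
    congr 1
    ext ω
    simp only [Set.mem_preimage, Set.mem_Iio, Set.mem_ofPred_eq, Finset.sum_sub_distrib]
    rw [inv_mul_lt_iff₀ (Real.sqrt_pos.2 (hVpos n hn)), sub_lt_iff_lt_add']
  · intro z
    -- Shifting by N makes the gamma parameters positive at every index.
    rw [← tendsto_add_atTop_iff_nat N]
    have hN : ∀ n, 0 < M (n + N) ∧ 0 < √(V (n + N)) := fun n =>
      ⟨hMpos _ (Nat.le_add_left _ _), Real.sqrt_pos.2 (hVpos _ (Nat.le_add_left _ _))⟩
    have hgprob : ∀ n, IsProbabilityMeasure (gammaMeasure (M (n + N) ^ 2 / √(V (n + N)) ^ 2)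
        (M (n + N) / √(V (n + N)) ^ 2)) := fun n => by
      obtain ⟨h1, h2⟩ := hN n
      exact isProbabilityMeasure_gammaMeasure (by positivity) (by positivity)
    have hchar := tendsto_charFun_gammaMeasure (fun n => (hN n).1) (fun n => (hN n).2)
      (hratio.comp (tendsto_add_atTop_nat N))
    have hprob : ∀ n, IsProbabilityMeasure
        ((gammaMeasure (M (n + N) ^ 2 / √(V (n + N)) ^ 2) (M (n + N) / √(V (n + N)) ^ 2)).map
          fun x => (√(V (n + N)))⁻¹ * (x - M (n + N))) := fun n =>
      Measure.isProbabilityMeasure_map (by fun_prop)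
    refine (tendsto_measureReal_Iic_of_tendsto_charFun hchar z).1.congr fun n => ?_
    obtain ⟨h1, h2⟩ := hN n
    have h3 := hVpos (n + N) (Nat.le_add_left _ _)
    have h4 := hnpos (n + N) (Nat.le_add_left _ _)
    have e1 : ((n + N : ℕ) : ℝ) * avg m (n + N) ^ 2 / avg v (n + N) =
        M (n + N) ^ 2 / √(V (n + N)) ^ 2 := by
      rw [Real.sq_sqrt h3.le]
      change ((n + N : ℕ) : ℝ) * (M (n + N) / (n + N : ℕ)) ^ 2 / (V (n + N) / (n + N : ℕ)) = _
      field_simp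
    have e2 : (avg v (n + N) / avg m (n + N))⁻¹ = M (n + N) / √(V (n + N)) ^ 2 := by
      rw [Real.sq_sqrt h3.le]
      change ((V (n + N) / (n + N : ℕ)) / (M (n + N) / (n + N : ℕ)))⁻¹ = _
      field_simp
    rw [e1, e2, cdf_eq_real, map_measureReal_apply (by fun_prop) measurableSet_Iic]
    congr 1
    ext x
    simp only [Set.mem_preimage, Set.mem_Iic]
    rw [inv_mul_le_iff₀ h2, sub_le_iff_le_add']

/-! ### Transfer to the probability space and conclusion -/

section Scores

variable {Ω : Type*} [MeasurableSpace Ω] {μ : Measure Ω} [IsProbabilityMeasure μ] {X : Ω → ℝ}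
  {h : ℝ → ℝ} {s : Set ℝ}

theorem integrable_abs_comp_sub_rpow (hX : Measurable X) (hs : s.Countable)
    (hXs : ∀ᵐ ω ∂μ, X ω ∈ s) (hm : Measurable h) (h0 : ∀ x, 0 ≤ h x)
    (hle : ∀ x, h x ≤ 2 - 2 * Real.log ((μ.map X).real (Set.Iic x))) (c : ℝ) {q : ℝ}
    (hq : 0 ≤ q) : Integrable (fun ω => |h (X ω) - c| ^ q) μ := by
  have := Measure.isProbabilityMeasure_map (μ := μ) hX.aemeasurable
  exact (integrable_abs_sub_rpow hs ((ae_map_iff hX.aemeasurable hs.measurableSet).2 hXs) hm h0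
    hle c hq).comp_measurable hX

theorem memLp_two_comp (hX : Measurable X) (hs : s.Countable)
    (hXs : ∀ᵐ ω ∂μ, X ω ∈ s) (hm : Measurable h) (h0 : ∀ x, 0 ≤ h x)
    (hle : ∀ x, h x ≤ 2 - 2 * Real.log ((μ.map X).real (Set.Iic x))) :
    MemLp (fun ω => h (X ω)) 2 μ := by
  refine (memLp_two_iff_integrable_sq (hm.comp hX).aestronglyMeasurable).2 ?_
  simpa using integrable_abs_comp_sub_rpow hX hs hXs hm h0 hle 0 zero_le_two

theorem variance_comp_le (hX : Measurable X) (hs : s.Countable)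
    (hXs : ∀ᵐ ω ∂μ, X ω ∈ s) (hm : Measurable h) (h0 : ∀ x, 0 ≤ h x)
    (hle : ∀ x, h x ≤ 2 - 2 * Real.log ((μ.map X).real (Set.Iic x))) :
    variance (fun ω => h (X ω)) μ ≤ 64 * Real.exp (1 / 2) := by
  have := Measure.isProbabilityMeasure_map (μ := μ) hX.aemeasurable
  refine (variance_le_expectation_sq (hm.comp hX).aestronglyMeasurable).trans ?_
  have := integral_sq_le hs ((ae_map_iff hX.aemeasurable hs.measurableSet).2 hXs) h0 hle
  rwa [integral_map hX.aemeasurable (by fun_prop)] at this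

theorem integral_meanStat (hX : Measurable X) (hs : s.Countable) (hXs : ∀ᵐ ω ∂μ, X ω ∈ s) :
    ∫ ω, meanStat μ X ω ∂μ = 2 := by
  have := Measure.isProbabilityMeasure_map (μ := μ) hX.aemeasurable
  rw [← integral_meanValueChiSq hs ((ae_map_iff hX.aemeasurable hs.measurableSet).2 hXs),
    integral_map hX.aemeasurable measurable_meanValueChiSq.aestronglyMeasurable]
  rfl

theorem one_le_integral_medianStat (hX : Measurable X) (hs : s.Countable)
    (hXs : ∀ᵐ ω ∂μ, X ω ∈ s) : 1 ≤ ∫ ω, medianStat μ X ω ∂μ := by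
  have := Measure.isProbabilityMeasure_map (μ := μ) hX.aemeasurable
  have := one_le_integral_medianValueChiSq hs
    ((ae_map_iff hX.aemeasurable hs.measurableSet).2 hXs)
  rwa [integral_map hX.aemeasurable measurable_medianValueChiSq.aestronglyMeasurable] at this

end Scores

theorem proposition2 {Ω : Type*} [MeasurableSpace Ω] (μ : Measure Ω) [IsProbabilityMeasure μ]
    (X : ℕ → Ω → ℝ) (hX : ∀ j, Measurable (X j))
    (hdisc : ∀ j, ∃ s : Set ℝ, s.Countable ∧ ∀ᵐ ω ∂μ, X j ω ∈ s)
    (hind : iIndepFun (fun j => meanStat μ (X j)) μ)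
    (hind' : iIndepFun (fun j => medianStat μ (X j)) μ)
    (ν m v : ℕ → ℝ)
    (hν : ∀ j, ν j = variance (meanStat μ (X j)) μ)
    (hm : ∀ j, m j = ∫ ω, medianStat μ (X j) ω ∂μ)
    (hv : ∀ j, v j = variance (medianStat μ (X j)) μ)
    (hνpos : ∃ j, 0 < ν j) (hvpos : ∃ j, 0 < v j)
    (δ δ' : ℝ) (hδ : 0 < δ) (hδ' : 0 < δ')
    (hLyap : Tendsto (fun n : ℕ =>
      (∑ j ∈ Finset.range n, ∫ ω, |meanStat μ (X j) ω - 2| ^ (2 + δ) ∂μ) /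
        (∑ j ∈ Finset.range n, ν j) ^ (1 + δ / 2)) atTop (𝓝 0))
    (hLyap' : Tendsto (fun n : ℕ =>
      (∑ j ∈ Finset.range n, ∫ ω, |medianStat μ (X j) ω - m j| ^ (2 + δ') ∂μ) /
        (∑ j ∈ Finset.range n, v j) ^ (1 + δ' / 2)) atTop (𝓝 0))
    (p : ℝ) (hp0 : 0 < p) (hp1 : p < 1) :
    Tendsto (fun n : ℕ => μ.real {ω | ∑ j ∈ Finset.range n, meanStat μ (X j) ω <
      gammaQuantile p (4 * n / avg ν n) (avg ν n / 2)}) atTop (𝓝 p) ∧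
    Tendsto (fun n : ℕ => μ.real {ω | ∑ j ∈ Finset.range n, medianStat μ (X j) ω <
      gammaQuantile p (n * avg m n ^ 2 / avg v n) (avg v n / avg m n)}) atTop (𝓝 p) := by
  have hprob : ∀ j, IsProbabilityMeasure (μ.map (X j)) := fun j =>
    Measure.isProbabilityMeasure_map (hX j).aemeasurable
  choose s hs hXs using hdisc
  have hmean1 := fun j => meanValueChiSq_nonneg (ρ := μ.map (X j))
  have hmean2 := fun j => meanValueChiSq_le (ρ := μ.map (X j))
  have hmedian1 := fun j => medianValueChiSq_nonneg (ρ := μ.map (X j))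
  have hmedian2 := fun j => medianValueChiSq_le (ρ := μ.map (X j))
  constructor
  -- Constant mean 2 turns the shape into n · 2² divided by the average variance.
  · have h := tendsto_measureReal_sum_lt_gammaQuantile (m := fun _ => 2) hδ
      (fun j => memLp_two_comp (hX j) (hs j) (hXs j) measurable_meanValueChiSq (hmean1 j)
        (hmean2 j))
      (fun j => integrable_abs_comp_sub_rpow (hX j) (hs j) (hXs j) measurable_meanValueChiSq
        (hmean1 j) (hmean2 j) 2 (by positivity)) hind
      (fun j => (integral_meanStat (hX j) (hs j) (hXs j)).symm) hν (fun _ => one_le_two)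
      (fun j => (hν j).trans_le (variance_comp_le (hX j) (hs j) (hXs j) measurable_meanValueChiSq
        (hmean1 j) (hmean2 j))) hνpos hLyap hp0 hp1
    refine h.congr' ?_
    filter_upwards [eventually_gt_atTop 0] with n hn
    have hn' : (n : ℝ) ≠ 0 := by positivity
    have : avg (fun _ => 2) n = 2 := by
      simp [avg, hn']
    rw [this, show (n : ℝ) * 2 ^ 2 = 4 * n by ring]
    rfl
  · exact tendsto_measureReal_sum_lt_gammaQuantile hδ'
      (fun j => memLp_two_comp (hX j) (hs j) (hXs j) measurable_medianValueChiSq (hmedian1 j)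
        (hmedian2 j))
      (fun j => integrable_abs_comp_sub_rpow (hX j) (hs j) (hXs j) measurable_medianValueChiSq
        (hmedian1 j) (hmedian2 j) (m j) (by positivity)) hind' hm hv
      (fun j => (one_le_integral_medianStat (hX j) (hs j) (hXs j)).trans_eq (hm j).symm)
      (fun j => (hv j).trans_le (variance_comp_le (hX j) (hs j) (hXs j)
        measurable_medianValueChiSq (hmedian1 j) (hmedian2 j))) hvpos hLyap' hp0 hp1
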